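/- For every real $\varepsilon>0$ one has $$\chi\bigl(\mathbb{R}^2\times[0,\varepsilon]^2\bigr)\ \ge\ 6,$$ where $\mathbb{R}^2\times[0,\varepsilon]^2=\{(x,y,z,t)\in\mathbb{R}^4 : z,t\in[0,\varepsilon]\}$ carries the Euclidean metric of $\mathbb{R}^4$, and $\chi(X)$ denotes the chromatic number of the graph whose vertices are the points of $X$ and whose edges join exactly the pairs of points at distance $1$. In other words, for every colouring of $\mathbb{R}^2\times[0,\varepsilon]^2$ with at most $5$ colours there are two points of the same colour at Euclidean distance exactly $1$. -/

import Mathlib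

/-- The unit-distance graph of a metric space: the vertices are the points of the space, and two
points are adjacent exactly when their distance is `1`. -/
def unitDistanceGraph (X : Type*) [MetricSpace X] : SimpleGraph X where
  Adj x y := dist x y = 1
  symm := ⟨fun x y h => by rw [dist_comm]; exact h⟩
  loopless := ⟨fun x h => by simp at h⟩

/-- The layer `ℝ² × [0, ε]²`, that is, the set of all `(x, y, z, t)` in Euclidean `ℝ⁴` with
`z, t ∈ [0, ε]`. As a subtype it carries the Euclidean metric. -/
def planeTimesSquare (ε : ℝ) : Set (EuclideanSpace ℝ (Fin 4)) :=
  {p | p 2 ∈ Set.Icc 0 ε ∧ p 3 ∈ Set.Icc 0 ε}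

/-! In `ℝ⁴` the points at unit distance from the three vertices of a small triangle form a circle.
If an odd unit polygon fits in that circle, a five-colouring cannot make the triangle rainbow: the
circle would be left with two colours. For a steep triangle, nearly parallel to the two thin
directions, the circle is nearly horizontal and stays in the layer (`triangle_not_rainbow`).

An antisymmetric function `w` of two colours sums to zero around a non-rainbow triangle, so its
total along a closed zigzag does not change across a band of such triangles. Antiprism bands, with
heights alternately in the two thin coordinates, shrink a zigzag around the axis until it can be
coned off; hence its total vanishes (`zigzagWinding_eq_zero`).

Suppose two axis points at distance `d` had different colours. Their common unit sphere would be
three-coloured, and it carries a zigzag whose vertex `i + m` is at unit distance from vertices `i`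
and `i + 1`. Zero winding lifts the three-colouring to a periodic integer sequence, which these unit
distances rule out (`axis_color_eq`). So steep steps of length `d` preserve colour, and a chain of
them joins two points at distance one. -/

/-- A five-colouring of `ℝ⁴`, given in coordinates, that is proper for unit distances inside the
thickened disc `{x² + y² ≤ 16, |z| ≤ ε, |t| ≤ ε}`. -/
def ProperOnThickDisc (ε : ℝ) (F : ℝ → ℝ → ℝ → ℝ → Fin 5) : Prop :=
  ∀ x y z t x' y' z' t' : ℝ, x ^ 2 + y ^ 2 ≤ 16 → |z| ≤ ε → |t| ≤ ε →
    x' ^ 2 + y' ^ 2 ≤ 16 → |z'| ≤ ε → |t'| ≤ ε →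
    (x - x') ^ 2 + (y - y') ^ 2 + (z - z') ^ 2 + (t - t') ^ 2 = 1 → F x y z t ≠ F x' y' z' t'

theorem ProperOnThickDisc.swap {ε : ℝ} {F : ℝ → ℝ → ℝ → ℝ → Fin 5}
    (hF : ProperOnThickDisc ε F) : ProperOnThickDisc ε (fun x y z t => F x y t z) := by
  intro x y z t x' y' z' t' h1 h2 h3 h4 h5 h6 h
  exact hF _ _ _ _ _ _ _ _ h1 h3 h2 h4 h6 h5 (by linarith)

theorem ProperOnThickDisc.rotate {ε : ℝ} {F : ℝ → ℝ → ℝ → ℝ → Fin 5}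
    (hF : ProperOnThickDisc ε F) (θ : ℝ) :
    ProperOnThickDisc ε (fun x y z t =>
      F (x * Real.cos θ - y * Real.sin θ) (x * Real.sin θ + y * Real.cos θ) z t) := by
  intro x y z t x' y' z' t' h1 h2 h3 h4 h5 h6 h
  have hθ := Real.sin_sq_add_cos_sq θ
  refine hF _ _ _ _ _ _ _ _ ?_ h2 h3 ?_ h5 h6 ?_
  · linear_combination h1 + (x ^ 2 + y ^ 2) * hθ
  · linear_combination h4 + (x' ^ 2 + y' ^ 2) * hθ
  · linear_combination h + ((x - x') ^ 2 + (y - y') ^ 2) * hθ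

/-! ### Rainbow triangles and odd unit polygons -/

theorem eq_of_avoid_three {a b c x y z : Fin 5} (hab : a ≠ b) (hac : a ≠ c) (hbc : b ≠ c)
    (hx : x ≠ a ∧ x ≠ b ∧ x ≠ c) (hy : y ≠ a ∧ y ≠ b ∧ y ≠ c) (hz : z ≠ a ∧ z ≠ b ∧ z ≠ c)
    (hxy : x ≠ y) (hyz : y ≠ z) : x = z := by
  have h : ({a, b, c, x, y} : Finset (Fin 5)) = Finset.univ := by
    rw [← Finset.card_eq_iff_eq_univ, Fintype.card_fin]
    simp [Finset.card_insert_of_notMem, hab, hac, hbc, hx.1.symm, hx.2.1.symm, hx.2.2.symm,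
      hy.1.symm, hy.2.1.symm, hy.2.2.symm, hxy]
  have hmem : z ∈ ({a, b, c, x, y} : Finset (Fin 5)) := h ▸ Finset.mem_univ z
  simp [hz.1, hz.2.1, hz.2.2, hyz.symm] at hmem
  exact hmem.symm

/-- An odd cycle cannot be coloured by five colours three of which are forbidden. -/
theorem false_of_odd_cycle {a b c : Fin 5} (hab : a ≠ b) (hac : a ≠ c) (hbc : b ≠ c)
    (g : ℕ → Fin 5) (hg : ∀ j, g j ≠ a ∧ g j ≠ b ∧ g j ≠ c) (hs : ∀ j, g j ≠ g (j + 1))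
    {q : ℕ} (hq : Odd q) (hper : g q = g 0) : False := by
  have h2 : ∀ j, g j = g (j + 2) := fun j =>
    eq_of_avoid_three hab hac hbc (hg _) (hg _) (hg _) (hs j) (hs (j + 1))
  obtain ⟨k, rfl⟩ := hq
  have h : ∀ k, g (2 * k + 1) = g 1 := by
    intro k
    induction k with
    | zero => rfl
    | succ k ih => rw [← ih, h2 (2 * k + 1)]; rfl
  exact hs 0 (by rw [← hper, h])

set_option maxHeartbeats 1000000 in
/-- A steep isosceles triangle whose circumradius `r` is such that the circle of radius
`σ = √(1 - r²)` carries a unit polygon with an odd number of vertices is not rainbow. -/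
theorem ProperOnThickDisc.triangle_not_rainbow {ε : ℝ} {F : ℝ → ℝ → ℝ → ℝ → Fin 5}
    (hF : ProperOnThickDisc ε F) {L μ σ : ℝ} (hL : 0 < L) (hμ : 0 < μ) (hLμ : 4 * (L + μ) ≤ ε ^ 2)
    (hε : 0 < ε) (hσ0 : 0 < σ) (hσ : σ ^ 2 * (L + μ) = L + μ - (L + μ / 2) ^ 2)
    {p q : ℕ} (hq : Odd q) (hpq : 2 * σ * Real.sin (Real.pi * p / q) = 1)
    {a b e z w : ℝ} (hz : z ^ 2 + b ^ 2 = L) (hw : w ^ 2 + e ^ 2 = L + μ) (ha : |a| ≤ 1)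
    (hb1 : |b| ≤ 1) (he1 : |e| ≤ 1)
    (hb : b ^ 2 ≤ ε ^ 2 * L) (he : 4 * e ^ 2 ≤ ε ^ 2 * L) :
    F a (-b) z 0 = F a b (-z) 0 ∨ F a (-b) z 0 = F (a + e) 0 0 w ∨
      F a b (-z) 0 = F (a + e) 0 0 w := by
  by_contra hcon
  push Not at hcon
  obtain ⟨hab, hac, hbc⟩ := hcon
  set A := √L with hA
  set g := √(L + μ) with hg
  have hA0 : 0 < A := Real.sqrt_pos.2 hL
  have hg0 : 0 < g := Real.sqrt_pos.2 (by linarith)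
  have hA2 : A ^ 2 = L := Real.sq_sqrt hL.le
  have hg2 : g ^ 2 = L + μ := Real.sq_sqrt (by linarith)
  -- The circumcentre divides the altitude in the ratio `l : 1 - l`, counted from the midpoint of
  -- the base.
  set l := μ / (2 * (L + μ)) with hl
  have hl' : 2 * l * g ^ 2 = μ := by rw [hl, hg2]; field_simp
  have hl0 : 0 ≤ l := by positivity
  have hl1 : 2 * l ≤ 1 := by
    have : 2 * l * g ^ 2 ≤ 1 * g ^ 2 := by rw [hl', hg2]; linarith
    exact le_of_mul_le_mul_right this (by positivity)
  have hσ1 : σ ^ 2 ≤ 1 := by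
    have : σ ^ 2 * (L + μ) ≤ 1 * (L + μ) := by rw [hσ]; nlinarith [sq_nonneg (L + μ / 2)]
    exact le_of_mul_le_mul_right this (by positivity)
  have hσle : σ ≤ 1 := by nlinarith
  have hσg : σ ^ 2 + (1 - l) ^ 2 * g ^ 2 = 1 := by
    have h1 : (σ ^ 2 + (1 - l) ^ 2 * g ^ 2) * g ^ 2 = 1 * g ^ 2 := by
      have : ((1 - l) * g ^ 2) = L + μ / 2 := by linear_combination hg2 - hl' / 2
      calc (σ ^ 2 + (1 - l) ^ 2 * g ^ 2) * g ^ 2 = σ ^ 2 * g ^ 2 + ((1 - l) * g ^ 2) ^ 2 := by ring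
        _ = 1 * g ^ 2 := by rw [this, hg2, hσ]; ring
    exact mul_right_cancel₀ (by positivity) h1
  have hlg : l ^ 2 * g ^ 2 + A ^ 2 = (1 - l) ^ 2 * g ^ 2 := by
    linear_combination hA2 - hg2 + hl'
  -- normalised components
  set Z := z / A
  set b' := b / A
  set W := w / g
  set e' := e / g
  have hzZ : z = A * Z := by simp only [Z]; field_simp
  have hbb : b = A * b' := by simp only [b']; field_simp
  have hwW : w = g * W := by simp only [W]; field_simp
  have hee : e = g * e' := by simp only [e']; field_simp
  have hZ1 : Z ^ 2 + b' ^ 2 = 1 := by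
    have : A ^ 2 * (Z ^ 2 + b' ^ 2) = A ^ 2 * 1 := by
      rw [hzZ, hbb] at hz; rw [← hA2] at hz; linear_combination hz
    exact mul_left_cancel₀ (by positivity) this
  have hW1 : W ^ 2 + e' ^ 2 = 1 := by
    have : g ^ 2 * (W ^ 2 + e' ^ 2) = g ^ 2 * 1 := by
      rw [hwW, hee] at hw; rw [← hg2] at hw; linear_combination hw
    exact mul_left_cancel₀ (by positivity) this
  have hb'ε : |b'| ≤ ε := by
    apply abs_le_of_sq_le_sq _ hε.le
    have : A ^ 2 * b' ^ 2 ≤ A ^ 2 * ε ^ 2 := by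
      rw [hbb, ← hA2] at hb; linarith [hb]
    exact le_of_mul_le_mul_left this (by positivity)
  have he'ε : |e'| ≤ ε / 2 := by
    apply abs_le_of_sq_le_sq _ (by positivity)
    have : g ^ 2 * e' ^ 2 ≤ g ^ 2 * (ε / 2) ^ 2 := by
      have h1 : ε ^ 2 * L ≤ ε ^ 2 * g ^ 2 := by
        apply mul_le_mul_of_nonneg_left _ (by positivity); linarith
      rw [hee] at he; linarith
    exact le_of_mul_le_mul_left this (by positivity)
  have hwε : |w| ≤ ε / 2 := by
    apply abs_le_of_sq_le_sq _ (by positivity); linarith [sq_nonneg e]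
  have hzε : |z| ≤ ε := by
    apply abs_le_of_sq_le_sq _ (by positivity); linarith [sq_nonneg b, sq_nonneg ε]
  have hW' : |W| ≤ 1 := by apply abs_le_of_sq_le_sq _ zero_le_one; linarith [sq_nonneg e']
  have hZ' : |Z| ≤ 1 := by apply abs_le_of_sq_le_sq _ zero_le_one; linarith [sq_nonneg b']
  have h0ε : |(0 : ℝ)| ≤ ε := by simpa using hε.le
  have hσc : ∀ t, |σ * Real.cos t| ≤ 1 := fun t => by
    rw [abs_mul, abs_of_pos hσ0]; exact mul_le_one₀ hσle (abs_nonneg _) (Real.abs_cos_le_one t)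
  have hσs : ∀ t, |σ * Real.sin t| ≤ 1 := fun t => by
    rw [abs_mul, abs_of_pos hσ0]; exact mul_le_one₀ hσle (abs_nonneg _) (Real.abs_sin_le_one t)
  -- membership of the circle in the thick disc
  have hm1 : ∀ t, (a + l * e + σ * Real.sin t * W) ^ 2 + (σ * Real.cos t * Z) ^ 2 ≤ 16 := by
    intro t
    have i1 : |σ * Real.sin t * W| ≤ 1 := by
      rw [abs_mul]; exact mul_le_one₀ (hσs t) (abs_nonneg _) hW'
    have i2 : |σ * Real.cos t * Z| ≤ 1 := by
      rw [abs_mul]; exact mul_le_one₀ (hσc t) (abs_nonneg _) hZ'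
    have i3 : |l * e| ≤ 1 := by
      rw [abs_mul, abs_of_nonneg hl0]; exact mul_le_one₀ (by linarith) (abs_nonneg _) he1
    have i4 : |a + l * e + σ * Real.sin t * W| ≤ 3 := by
      rw [abs_le] at *; constructor <;> linarith
    have i5 := sq_le_sq' (abs_le.1 i4).1 (abs_le.1 i4).2
    have i6 := sq_le_sq' (abs_le.1 i2).1 (abs_le.1 i2).2
    linarith
  have hm2 : ∀ t, |σ * Real.cos t * b'| ≤ ε := by
    intro t
    rw [abs_mul]
    calc _ ≤ 1 * ε := mul_le_mul (hσc t) hb'ε (abs_nonneg _) zero_le_one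
      _ = ε := one_mul _
  have hm3 : ∀ t, |l * w - σ * Real.sin t * e'| ≤ ε := by
    intro t
    have i1 : |σ * Real.sin t * e'| ≤ 1 * (ε / 2) := by
      rw [abs_mul]; exact mul_le_mul (hσs t) he'ε (abs_nonneg _) zero_le_one
    have i2 : |l * w| ≤ 1 * (ε / 2) := by
      rw [abs_mul, abs_of_nonneg hl0]; exact mul_le_mul (by linarith) hwε (abs_nonneg _) zero_le_one
    rw [abs_le] at *; constructor <;> linarith
  have ha2 : a ^ 2 ≤ 1 := (sq_le_one_iff_abs_le_one a).2 ha
  have hb2 : b ^ 2 ≤ 1 := (sq_le_one_iff_abs_le_one b).2 hb1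
  have he2 : e ^ 2 ≤ 1 := (sq_le_one_iff_abs_le_one e).2 he1
  have hP : a ^ 2 + (-b) ^ 2 ≤ 16 := by linarith [neg_sq b]
  have hQ : a ^ 2 + b ^ 2 ≤ 16 := by linarith [neg_sq b]
  have hR : (a + e) ^ 2 + (0 : ℝ) ^ 2 ≤ 16 := by nlinarith [sq_nonneg (a - e)]
  -- The circle about the circumcentre in the plane orthogonal to the triangle, spanned by the unit
  -- vectors `(0, Z, b', 0)` and `(W, 0, 0, -e')`.
  set c : ℝ → Fin 5 := fun t => F (a + l * e + σ * Real.sin t * W) (σ * Real.cos t * Z)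
    (σ * Real.cos t * b') (l * w - σ * Real.sin t * e') with hc
  have hcol : ∀ t, c t ≠ F a (-b) z 0 ∧ c t ≠ F a b (-z) 0 ∧ c t ≠ F (a + e) 0 0 w := by
    intro t
    have hsc := Real.sin_sq_add_cos_sq t
    refine ⟨hF _ _ _ _ _ _ _ _ (hm1 t) (hm2 t) (hm3 t) hP hzε h0ε ?_,
      hF _ _ _ _ _ _ _ _ (hm1 t) (hm2 t) (hm3 t) hQ (by simpa using hzε) h0ε ?_,
      hF _ _ _ _ _ _ _ _ (hm1 t) (hm2 t) (hm3 t) hR h0ε (by linarith) ?_⟩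
    · rw [hzZ, hbb, hwW, hee]
      linear_combination (l ^ 2 * g ^ 2 + σ ^ 2 * Real.sin t ^ 2) * hW1 +
        (A ^ 2 + σ ^ 2 * Real.cos t ^ 2) * hZ1 + σ ^ 2 * hsc + hlg + hσg
    · rw [hzZ, hbb, hwW, hee]
      linear_combination (l ^ 2 * g ^ 2 + σ ^ 2 * Real.sin t ^ 2) * hW1 +
        (A ^ 2 + σ ^ 2 * Real.cos t ^ 2) * hZ1 + σ ^ 2 * hsc + hlg + hσg
    · rw [hwW, hee]
      linear_combination ((1 - l) ^ 2 * g ^ 2 + σ ^ 2 * Real.sin t ^ 2) * hW1 +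
        (σ ^ 2 * Real.cos t ^ 2) * hZ1 + σ ^ 2 * hsc + hσg
  have hq0 : (q : ℝ) ≠ 0 := by
    have := hq.pos; positivity
  set β := 2 * (Real.pi * p / q) with hβ
  have hstep : ∀ t, c t ≠ c (t + β) := by
    intro t
    refine hF _ _ _ _ _ _ _ _ (hm1 _) (hm2 _) (hm3 _) (hm1 _) (hm2 _) (hm3 _) ?_
    have hcosβ : σ ^ 2 * (2 - 2 * Real.cos β) = 1 := by
      rw [hβ, Real.cos_two_mul, Real.cos_sq']
      linear_combination (2 * σ * Real.sin (Real.pi * p / q) + 1) * hpq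
    have h1 := Real.sin_sq_add_cos_sq t
    have h2 := Real.sin_sq_add_cos_sq β
    rw [Real.sin_add, Real.cos_add]
    generalize Real.sin t = s at *
    generalize Real.cos t = k at *
    generalize Real.sin β = s' at *
    generalize Real.cos β = k' at *
    linear_combination (σ ^ 2 * (s - (s * k' + k * s')) ^ 2) * hW1 +
        (σ ^ 2 * (k - (k * k' - s * s')) ^ 2) * hZ1 + hcosβ +
        σ ^ 2 * (1 - 2 * k' + k' ^ 2 + s' ^ 2) * h1 + σ ^ 2 * h2
  refine false_of_odd_cycle hab hac hbc (fun j => c (j * β)) (fun j => hcol _) (fun j => ?_) hq ?_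
  · have := hstep (j * β)
    push_cast
    rwa [add_mul, one_mul]
  · have : (q : ℝ) * β = 0 + p * (2 * Real.pi) := by rw [hβ]; field_simp; ring
    simp only [hc, this, Real.sin_add_nat_mul_two_pi, Real.cos_add_nat_mul_two_pi]
    simp

/-! ### Cochains on colours and stacks of antiprisms -/

theorem cocycle_of_not_rainbow {κ : Type*} {w : κ → κ → ℤ} (hw : ∀ i j, w i j = -w j i)
    {a b c : κ} (h : a = b ∨ a = c ∨ b = c) : w a b + w b c + w c a = 0 := by
  have hd : ∀ i, w i i = 0 := fun i => by have := hw i i; omega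
  rcases h with rfl | rfl | rfl
  · have := hw a c; have := hd a; omega
  · have := hw a b; have := hd a; omega
  · have := hw a b; have := hd b; omega

/-- Parameters for which every isosceles triangle with half-base squared `L` and altitude squared
`L + μ` that occurs in a stack of antiprisms with angular step `B` cannot be rainbow. -/
structure AntiprismParameters (ε B L μ : ℝ) : Prop where
  eps_pos : 0 < ε
  half_base_pos : 0 < L
  excess_pos : 0 < μ
  small : 4 * (L + μ) ≤ ε ^ 2
  cos_pos : 0 < Real.cos B
  excess_le : μ ≤ Real.sin B ^ 2
  steep : 8 * Real.sin B ^ 2 ≤ ε ^ 2 * L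
  polygon : ∃ (σ : ℝ) (p q : ℕ), 0 < σ ∧ σ ^ 2 * (L + μ) = L + μ - (L + μ / 2) ^ 2 ∧ Odd q ∧
    2 * σ * Real.sin (Real.pi * p / q) = 1

theorem AntiprismParameters.triangle_cocycle {ε B L μ : ℝ} (hp : AntiprismParameters ε B L μ)
    {F : ℝ → ℝ → ℝ → ℝ → Fin 5} (hF : ProperOnThickDisc ε F)
    {w : Fin 5 → Fin 5 → ℤ} (hw : ∀ i j, w i j = -w j i) {s s' z z' : ℝ}
    (hs0 : 0 ≤ s) (hs1 : s ≤ 1) (hs0' : 0 ≤ s') (hs1' : s' ≤ 1)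
    (hz : z ^ 2 + s ^ 2 * Real.sin B ^ 2 = L) (hz' : z' ^ 2 + (s' - Real.cos B * s) ^ 2 = L + μ)
    (hdiff : (s' - Real.cos B * s) ^ 2 ≤ μ + Real.sin B ^ 2) (θ : ℝ) :
    w (F (s * Real.cos (θ - B)) (s * Real.sin (θ - B)) z 0)
        (F (s * Real.cos (θ + B)) (s * Real.sin (θ + B)) (-z) 0) +
      w (F (s * Real.cos (θ + B)) (s * Real.sin (θ + B)) (-z) 0)
        (F (s' * Real.cos θ) (s' * Real.sin θ) 0 z') +
      w (F (s' * Real.cos θ) (s' * Real.sin θ) 0 z')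
        (F (s * Real.cos (θ - B)) (s * Real.sin (θ - B)) z 0) = 0 := by
  apply cocycle_of_not_rainbow hw
  obtain ⟨σ, p, q, hσ0, hσ, hq, hpq⟩ := hp.polygon
  have hC1 := Real.cos_le_one B
  have hC0 := hp.cos_pos
  have hS1 := abs_le.1 (Real.abs_sin_le_one B)
  have hs2 : s ^ 2 ≤ 1 := by nlinarith
  have hsS : s ^ 2 * Real.sin B ^ 2 ≤ Real.sin B ^ 2 :=
    mul_le_of_le_one_left (sq_nonneg _) hs2
  have hCs : Real.cos B * s ≤ 1 := by nlinarith
  have hCs0 : 0 ≤ Real.cos B * s := by positivity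
  -- Rotation by `θ` brings the apex over the first axis. Since `hdiff` and `excess_le` give `e ^ 2
  -- ≤ 2 * sin B ^ 2`, the factor 8 in `steep` is what the lemma needs.
  have key := (hF.rotate θ).triangle_not_rainbow hp.half_base_pos hp.excess_pos hp.small
    hp.eps_pos hσ0 hσ hq hpq
    (a := Real.cos B * s) (b := s * Real.sin B) (e := s' - Real.cos B * s) (z := z) (w := z')
    (by rw [← hz]; ring) hz' (by rw [abs_of_nonneg hCs0]; exact hCs)
    (by rw [abs_mul, abs_of_nonneg hs0]; exact mul_le_one₀ hs1 (abs_nonneg _)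
          (Real.abs_sin_le_one B))
    (by rw [abs_le]; constructor <;> linarith)
    (by rw [mul_pow]; nlinarith [hp.steep, sq_nonneg (Real.sin B)])
    (by linarith [hp.steep, hp.excess_le])
  have e1 : Real.cos B * s * Real.cos θ - -(s * Real.sin B) * Real.sin θ = s * Real.cos (θ - B) := by
    rw [Real.cos_sub]; ring
  have e2 : Real.cos B * s * Real.sin θ + -(s * Real.sin B) * Real.cos θ = s * Real.sin (θ - B) := by
    rw [Real.sin_sub]; ring
  have e3 : Real.cos B * s * Real.cos θ - (s * Real.sin B) * Real.sin θ = s * Real.cos (θ + B) := by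
    rw [Real.cos_add]; ring
  have e4 : Real.cos B * s * Real.sin θ + (s * Real.sin B) * Real.cos θ = s * Real.sin (θ + B) := by
    rw [Real.sin_add]; ring
  simpa only [e1, e2, e3, e4, add_sub_cancel, zero_mul, sub_zero, add_zero] using key

/-- The colour of the `i`-th vertex of a zigzag around the circle of radius `s`, with angular step
`2 * B` and heights alternating between `z` and `-z`. -/
noncomputable def zigzagColor (F : ℝ → ℝ → ℝ → ℝ → Fin 5) (B s z φ : ℝ) (i : ℕ) : Fin 5 :=
  F (s * Real.cos (φ + 2 * B * i)) (s * Real.sin (φ + 2 * B * i)) ((-1) ^ i * z) 0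

theorem zigzagColor_add {F : ℝ → ℝ → ℝ → ℝ → Fin 5} {B : ℝ} {N : ℕ} (hN : Even N)
    (hB : N * B = Real.pi) (s z φ : ℝ) (i : ℕ) :
    zigzagColor F B s z φ (i + N) = zigzagColor F B s z φ i := by
  have : φ + 2 * B * ((i + N : ℕ) : ℝ) = φ + 2 * B * i + 2 * Real.pi := by
    push_cast; linear_combination 2 * hB
  simp only [zigzagColor, this, Real.cos_add_two_pi, Real.sin_add_two_pi, pow_add, hN.neg_one_pow,
    mul_one]

/-- The total of the cochain `w` along a closed zigzag. -/
noncomputable def zigzagWinding (F : ℝ → ℝ → ℝ → ℝ → Fin 5) (w : Fin 5 → Fin 5 → ℤ) (N : ℕ)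
    (B s z φ : ℝ) : ℤ :=
  ∑ i ∈ Finset.range N, w (zigzagColor F B s z φ i) (zigzagColor F B s z φ (i + 1))

theorem AntiprismParameters.base_cocycle {ε B L μ : ℝ} (hp : AntiprismParameters ε B L μ)
    {F : ℝ → ℝ → ℝ → ℝ → Fin 5} (hF : ProperOnThickDisc ε F)
    {w : Fin 5 → Fin 5 → ℤ} (hw : ∀ i j, w i j = -w j i) {s s' z z' : ℝ}
    (hs0 : 0 ≤ s) (hs1 : s ≤ 1) (hs0' : 0 ≤ s') (hs1' : s' ≤ 1)
    (hz : z ^ 2 + s ^ 2 * Real.sin B ^ 2 = L) (hz' : z' ^ 2 + (s' - Real.cos B * s) ^ 2 = L + μ)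
    (hdiff : (s' - Real.cos B * s) ^ 2 ≤ μ + Real.sin B ^ 2) {φ θ : ℝ} (i : ℕ)
    (hθ : θ = φ + B + 2 * B * i) :
    w (zigzagColor F B s z φ i) (zigzagColor F B s z φ (i + 1)) +
      w (zigzagColor F B s z φ (i + 1)) (F (s' * Real.cos θ) (s' * Real.sin θ) 0 z') +
      w (F (s' * Real.cos θ) (s' * Real.sin θ) 0 z') (zigzagColor F B s z φ i) = 0 := by
  have key := hp.triangle_cocycle hF hw hs0 hs1 hs0' hs1' (z := (-1) ^ i * z)
    (by rw [mul_pow, ← pow_mul, mul_comm i 2, pow_mul, neg_one_sq, one_pow, one_mul, hz])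
    hz' hdiff θ
  have e1 : θ - B = φ + 2 * B * i := by rw [hθ]; ring
  have e2 : θ + B = φ + 2 * B * ((i + 1 : ℕ) : ℝ) := by rw [hθ]; push_cast; ring
  have e3 : -((-1) ^ i * z) = (-1) ^ (i + 1) * z := by rw [pow_succ]; ring
  rw [e1, e2, e3] at key
  exact key

/-- All base edges are joined to one apex on the axis, so the sum telescopes. Smallness of `s`
leaves room for an apex height giving altitude squared `L + μ`. -/
theorem AntiprismParameters.zigzagWinding_cone {ε B L μ : ℝ} (hp : AntiprismParameters ε B L μ)
    {F : ℝ → ℝ → ℝ → ℝ → Fin 5} (hF : ProperOnThickDisc ε F)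
    {w : Fin 5 → Fin 5 → ℤ} (hw : ∀ i j, w i j = -w j i) {N : ℕ} (hN : Even N)
    (hB : N * B = Real.pi) {s z : ℝ} (hs0 : 0 ≤ s) (hs1 : s ≤ 1)
    (hz : z ^ 2 + s ^ 2 * Real.sin B ^ 2 = L) (hs : Real.cos B ^ 2 * s ^ 2 < μ) (φ : ℝ) :
    zigzagWinding F w N B s z φ = 0 := by
  have hL := hp.half_base_pos
  set o := F 0 0 0 √(L + μ - Real.cos B ^ 2 * s ^ 2) with ho
  set c := zigzagColor F B s z φ with hc
  have h : ∀ i, w (c i) (c (i + 1)) = w o (c (i + 1)) - w o (c i) := by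
    intro i
    have key : w (c i) (c (i + 1)) + w (c (i + 1)) o + w o (c i) = 0 := by
      simpa only [zero_mul] using hp.base_cocycle hF hw hs0 hs1 le_rfl zero_le_one hz
        (z' := √(L + μ - Real.cos B ^ 2 * s ^ 2))
        (by rw [Real.sq_sqrt (by linarith)]; ring)
        (by nlinarith [sq_nonneg (Real.sin B)]) (φ := φ) i rfl
    have := hw (c (i + 1)) o
    omega
  have hper : c N = c 0 := by simpa using zigzagColor_add (F := F) hN hB s z φ 0
  simp only [zigzagWinding, ← hc]
  rw [Finset.sum_congr rfl fun i _ => h i, Finset.sum_range_sub (fun i => w o (c i)), hper, sub_self]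

/-- The two zigzags bound a band of triangles pointing alternately up and down. Adding the two
cocycle relations at each `i` leaves a telescoping difference. -/
theorem AntiprismParameters.zigzagWinding_step {ε B L μ : ℝ} (hp : AntiprismParameters ε B L μ)
    {F : ℝ → ℝ → ℝ → ℝ → Fin 5} (hF : ProperOnThickDisc ε F)
    {w : Fin 5 → Fin 5 → ℤ} (hw : ∀ i j, w i j = -w j i) {N : ℕ} (hN : Even N)
    (hB : N * B = Real.pi) {s s' z z' : ℝ} (hs0 : 0 ≤ s) (hs1 : s ≤ 1) (hs0' : 0 ≤ s')
    (hs1' : s' ≤ 1) (hz : z ^ 2 + s ^ 2 * Real.sin B ^ 2 = L)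
    (hz' : z' ^ 2 + s' ^ 2 * Real.sin B ^ 2 = L)
    (hss : (s' - Real.cos B * s) ^ 2 = μ + Real.sin B ^ 2 * s' ^ 2) (φ : ℝ) :
    zigzagWinding F w N B s z φ =
      zigzagWinding (fun x y z t => F x y t z) w N B s' z' (φ + B) := by
  set c := zigzagColor F B s z φ with hc
  set c' := zigzagColor (fun x y z t => F x y t z) B s' z' (φ + B) with hc'
  have hsc := Real.sin_sq_add_cos_sq B
  -- Both forms say `C² (s² + s'²) - 2 C s s' = μ` with `C = cos B`, so one relation serves the
  -- triangles of both orientations.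
  have hss' : (s - Real.cos B * s') ^ 2 = μ + Real.sin B ^ 2 * s ^ 2 := by
    linear_combination hss - (s ^ 2 - s' ^ 2) * hsc
  have hS := sq_nonneg (Real.sin B)
  have hsq : ∀ r : ℝ, 0 ≤ r → r ≤ 1 → Real.sin B ^ 2 * r ^ 2 ≤ Real.sin B ^ 2 := fun r h0 h1 =>
    mul_le_of_le_one_right hS (by nlinarith)
  have hpow : ∀ (j : ℕ) (x : ℝ), ((-1) ^ j * x) ^ 2 = x ^ 2 := fun j x => by
    rw [mul_pow, ← pow_mul, mul_comm j 2, pow_mul, neg_one_sq, one_pow, one_mul]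
  have h1 : ∀ i, w (c i) (c (i + 1)) + w (c (i + 1)) (c' i) + w (c' i) (c i) = 0 := by
    intro i
    exact hp.base_cocycle hF hw hs0 hs1 hs0' hs1' hz (z' := (-1) ^ i * z')
      (by rw [hpow]; linarith) (by linarith [hsq s' hs0' hs1']) i rfl
  have h2 : ∀ i, w (c' i) (c' (i + 1)) + w (c' (i + 1)) (c (i + 1)) + w (c (i + 1)) (c' i) = 0 := by
    intro i
    refine hp.base_cocycle hF.swap hw hs0' hs1' hs0 hs1 hz' (z' := (-1) ^ (i + 1) * z)
      (by rw [hpow]; linarith) (by linarith [hsq s hs0 hs1]) (φ := φ + B) i ?_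
    push_cast; ring
  have h : ∀ i, w (c i) (c (i + 1)) - w (c' i) (c' (i + 1)) =
      w (c' (i + 1)) (c (i + 1)) - w (c' i) (c i) := fun i => by
    have := h1 i; have := h2 i; omega
  have hper : c N = c 0 := by simpa using zigzagColor_add (F := F) hN hB s z φ 0
  have hper' : c' N = c' 0 := by
    simpa using zigzagColor_add (F := fun x y z t => F x y t z) hN hB s' z' (φ + B) 0
  rw [← sub_eq_zero]
  simp only [zigzagWinding, ← hc, ← hc']
  rw [← Finset.sum_sub_distrib, Finset.sum_congr rfl fun i _ => h i,
    Finset.sum_range_sub (fun i => w (c' i) (c i)), hper, hper', sub_self]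

/-- Each band lowers the radius by at least `√μ`, so finitely many bands reach the cone case. -/
theorem AntiprismParameters.zigzagWinding_eq_zero {ε B L μ : ℝ} (hp : AntiprismParameters ε B L μ)
    {F : ℝ → ℝ → ℝ → ℝ → Fin 5} (hF : ProperOnThickDisc ε F)
    {w : Fin 5 → Fin 5 → ℤ} (hw : ∀ i j, w i j = -w j i) {N : ℕ} (hN : Even N)
    (hB : N * B = Real.pi) {s z : ℝ} (hs0 : 0 ≤ s) (hs1 : s ≤ 1)
    (hz : z ^ 2 + s ^ 2 * Real.sin B ^ 2 = L) (φ : ℝ) :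
    zigzagWinding F w N B s z φ = 0 := by
  have hμ := hp.excess_pos
  obtain ⟨n, hn⟩ : ∃ n : ℕ, s ≤ n * √μ := by
    obtain ⟨n, hn⟩ := exists_nat_ge (s / √μ)
    exact ⟨n, (div_le_iff₀ (Real.sqrt_pos.2 hμ)).1 hn⟩
  induction n generalizing F s z φ with
  | zero =>
    have : s = 0 := le_antisymm (by simpa using hn) hs0
    exact hp.zigzagWinding_cone hF hw hN hB hs0 hs1 hz (by simpa [this] using hμ) φ
  | succ n ih =>
    by_cases hcone : Real.cos B ^ 2 * s ^ 2 < μ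
    · exact hp.zigzagWinding_cone hF hw hN hB hs0 hs1 hz hcone φ
    push Not at hcone
    have hC0 := hp.cos_pos
    have hC1 := Real.cos_le_one B
    have hsc := Real.sin_sq_add_cos_sq B
    set C := Real.cos B
    set S := Real.sin B
    set T := √(S ^ 2 * s ^ 2 + μ) with hT
    have hT2 : T ^ 2 = S ^ 2 * s ^ 2 + μ := Real.sq_sqrt (by positivity)
    have hT0 : 0 ≤ T := Real.sqrt_nonneg _
    have hTs : T ≤ s := abs_le_of_sq_le_sq' (by rw [hT2]; nlinarith) hs0 |>.2
    -- The smaller root of the band relation, written as `(s - C * s') ^ 2 = T ^ 2`.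
    obtain ⟨s', hs'⟩ : ∃ s', s' = (s - T) / C := ⟨_, rfl⟩
    have hCs' : C * s' = s - T := by rw [hs']; field_simp
    have hs0' : 0 ≤ s' := by rw [hs']; exact div_nonneg (by linarith) hC0.le
    have hss : (s' - C * s) ^ 2 = μ + S ^ 2 * s' ^ 2 := by
      have h : (s - C * s') ^ 2 = S ^ 2 * s ^ 2 + μ := by rw [hCs', ← hT2]; ring
      linear_combination h - (s' ^ 2 - s ^ 2) * hsc
    have hle : s' ≤ C * s := by
      have h1 : S ^ 2 * s ≤ T := by
        apply abs_le_of_sq_le_sq' _ hT0 |>.2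
        rw [hT2]
        have : S ^ 2 ≤ 1 := by nlinarith
        nlinarith [mul_nonneg (sq_nonneg S) (sq_nonneg s)]
      have h2 : C * s' ≤ C * (C * s) := by
        rw [hCs']; nlinarith
      exact le_of_mul_le_mul_left h2 hC0
    have hdec : s' ≤ s - √μ := by
      have h1 : √μ ≤ C * s - s' := by
        rw [Real.sqrt_le_left (by linarith)]
        nlinarith [mul_nonneg (sq_nonneg S) (sq_nonneg s')]
      nlinarith
    have hs's : s' ≤ s := by linarith [Real.sqrt_nonneg μ]
    have hz' : √(L - s' ^ 2 * S ^ 2) ^ 2 + s' ^ 2 * S ^ 2 = L := by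
      rw [Real.sq_sqrt]
      · ring
      · have : s' ^ 2 * S ^ 2 ≤ s ^ 2 * S ^ 2 := by gcongr
        nlinarith [sq_nonneg z]
    rw [hp.zigzagWinding_step hF hw hN hB hs0 hs1 hs0' (hs's.trans hs1) hz hz' hss]
    exact ih hF.swap hs0' (hs's.trans hs1) hz' _ (by push_cast at hn; linarith)

/-! ### Three-colourings of a cyclic zigzag -/

/-- A periodic integer sequence with steps at most one must take equal values at some of the
places `i`, `i + 1` and `i + m`. -/
theorem false_of_periodic_of_separated {f : ℕ → ℤ} {N m : ℕ} (hN : 0 < N)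
    (hper : Function.Periodic f N) (hstep : ∀ i, |f (i + 1) - f i| ≤ 1)
    (h0 : ∀ i, f (i + m) ≠ f i) (h1 : ∀ i, f (i + m) ≠ f (i + 1)) : False := by
  have hmN : f (N * m) = f 0 := by
    simpa [mul_comm] using hper.nat_mul m 0
  have hnext : ∀ i, f (i + 1 + m) = f (i + m + 1) := fun i => by congr 1; omega
  rcases lt_or_gt_of_ne (h0 0) with h | h
  · have hlt : ∀ i, f (i + m) < f i := by
      intro i
      induction i with
      | zero => exact h
      | succ i ih =>
        have a1 := abs_le.1 (hstep i)
        have a2 := abs_le.1 (hstep (i + m))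
        have := h1 i; have := h0 (i + 1); have := hnext i
        omega
    have hle : ∀ j : ℕ, f (j * m) ≤ f 0 - j := by
      intro j
      induction j with
      | zero => simp
      | succ j ih =>
        have := hlt (j * m)
        rw [add_mul, one_mul]; push_cast; omega
    have := hle N
    omega
  · have hlt : ∀ i, f i < f (i + m) := by
      intro i
      induction i with
      | zero => exact h
      | succ i ih =>
        have a1 := abs_le.1 (hstep i)
        have a2 := abs_le.1 (hstep (i + m))
        have := h1 i; have := h0 (i + 1); have := hnext i
        omega
    have hle : ∀ j : ℕ, f 0 + j ≤ f (j * m) := by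
      intro j
      induction j with
      | zero => simp
      | succ j ih =>
        have := hlt (j * m)
        rw [add_mul, one_mul]; push_cast; omega
    have := hle N
    omega

/-- Partial sums of the balanced residues lift the colouring to integers; `hsum` makes the lift
periodic. -/
theorem false_of_cyclic_three_colouring {c : ℕ → ℤ} {N m : ℕ} (hN : 0 < N)
    (hper : Function.Periodic c N)
    (hsum : ∑ i ∈ Finset.range N, (c (i + 1) - c i).bmod 3 = 0)
    (h0 : ∀ i, ¬ (3 : ℤ) ∣ c (i + m) - c i) (h1 : ∀ i, ¬ (3 : ℤ) ∣ c (i + m) - c (i + 1)) :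
    False := by
  set e : ℕ → ℤ := fun i => (c (i + 1) - c i).bmod 3 with he
  set f : ℕ → ℤ := fun n => ∑ i ∈ Finset.range n, e i with hf
  have hsucc : ∀ n, f (n + 1) = f n + e n := fun n => Finset.sum_range_succ _ _
  have he3 : ∀ i, (3 : ℤ) ∣ e i - (c (i + 1) - c i) := fun i => by
    simp only [he, Int.bmod]
    split_ifs <;> omega
  have hfc : ∀ n, (3 : ℤ) ∣ f n - (c n - c 0) := by
    intro n
    induction n with
    | zero => simp [hf]
    | succ n ih => have := he3 n; rw [hsucc]; omega
  have he1 : ∀ i, |e i| ≤ 1 := fun i => by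
    have h1 := Int.le_bmod (x := c (i + 1) - c i) (m := 3) (by norm_num)
    have h2 := Int.bmod_lt (x := c (i + 1) - c i) (m := 3) (by norm_num)
    simp only [he]
    rw [abs_le]
    constructor <;> omega
  have heper : Function.Periodic e N := fun i => by
    simp only [he]
    rw [hper i, show i + N + 1 = (i + 1) + N by omega, hper (i + 1)]
  have hfper : Function.Periodic f N := by
    intro n
    induction n with
    | zero => simpa [hf] using hsum
    | succ n ih => rw [show n + 1 + N = n + N + 1 by omega, hsucc, hsucc, ih, heper n]
  refine false_of_periodic_of_separated (m := m) hN hfper (fun i => ?_) (fun i h => ?_) fun i h => ?_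
  · rw [hsucc, add_sub_cancel_left]; exact he1 i
  · have := hfc (i + m); have := hfc i; have := h0 i; omega
  · have := hfc (i + m); have := hfc (i + 1); have := h1 i; omega

/-- The witness ranks the three remaining colours as 0, 1, 2. -/
theorem exists_injOn_mod_three (a b : Fin 5) (hab : a ≠ b) : ∃ c : Fin 5 → ℤ, ∀ i j,
    i ≠ a → i ≠ b → j ≠ a → j ≠ b → i ≠ j → ¬ (3 : ℤ) ∣ c i - c j := by
  refine ⟨fun i => (i : ℕ) - (if a < i then 1 else 0) - (if b < i then 1 else 0), ?_⟩
  revert a b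
  decide

theorem bmod_three_neg (x : ℤ) : (-x).bmod 3 = -x.bmod 3 := by
  simp only [Int.bmod]
  split_ifs <;> omega

/-- Two points on the axis at a certain small distance must receive the same colour, since otherwise
a unit-distance zigzag on the two-sphere around them would be three-coloured. -/
theorem AntiprismParameters.axis_color_eq {ε B L μ ρ z d : ℝ} (hp : AntiprismParameters ε B L μ)
    {F : ℝ → ℝ → ℝ → ℝ → Fin 5} (hF : ProperOnThickDisc ε F) {m : ℕ} (hm : Even m) (hm2 : 2 ≤ m)
    (hB : ((6 * (m - 1) : ℕ) : ℝ) * B = Real.pi) (hρ0 : 0 ≤ ρ) (hρ1 : ρ ≤ 1)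
    (hρ : 2 * ρ * Real.sin (Real.pi / 6 + B) = 1) (hz : 4 * z ^ 2 = 1 - ρ ^ 2)
    (hd : d ^ 2 = 3 * (1 - ρ ^ 2)) (hdε : |d| ≤ 2 * ε)
    (hL : L = z ^ 2 + ρ ^ 2 * Real.sin B ^ 2) : F 0 0 0 (d / 2) = F 0 0 0 (-(d / 2)) := by
  by_contra hne
  have hε := hp.eps_pos
  have hN : Even (6 * (m - 1)) := ⟨3 * (m - 1), by omega⟩
  -- Vertices `i` and `i + m` have equal height, as `m` is even, and half-angle `π / 6 + B`; `i + 1`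
  -- and `i + m` have opposite heights and half-angle `π / 6`.
  have hmB : (m : ℝ) * B = Real.pi / 6 + B := by
    push_cast [Nat.cast_sub (show 1 ≤ m by omega)] at hB
    linarith
  set x := zigzagColor F B ρ z 0 with hx
  have hxper : ∀ i, x (i + 6 * (m - 1)) = x i := zigzagColor_add hN hB ρ z 0
  have hzε : ∀ i : ℕ, |(-1) ^ i * z| ≤ ε := by
    intro i
    rw [abs_mul, abs_pow, abs_neg, abs_one, one_pow, one_mul]
    apply abs_le_of_sq_le_sq _ hε.le
    have := hp.small
    have := hp.excess_pos
    nlinarith [sq_nonneg (ρ * Real.sin B), sq_nonneg ε, sq_nonneg z]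
  have h0ε : |(0 : ℝ)| ≤ ε := by simpa using hε.le
  have hdε' : |d / 2| ≤ ε := by rw [abs_div, abs_two]; linarith
  have hdisc : ∀ t, (ρ * Real.cos t) ^ 2 + (ρ * Real.sin t) ^ 2 ≤ 16 := by
    intro t
    have : (ρ * Real.cos t) ^ 2 + (ρ * Real.sin t) ^ 2 = ρ ^ 2 := by
      linear_combination ρ ^ 2 * Real.sin_sq_add_cos_sq t
    rw [this]; nlinarith
  have hpow : ∀ i : ℕ, ((-1 : ℝ) ^ i) ^ 2 = 1 := fun i => by
    rw [← pow_mul, mul_comm i 2, pow_mul, neg_one_sq, one_pow]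
  have ha : ∀ i, x i ≠ F 0 0 0 (d / 2) := by
    intro i
    refine hF _ _ _ _ _ _ _ _ (hdisc _) (hzε i) h0ε (by norm_num) h0ε hdε' ?_
    linear_combination ρ ^ 2 * Real.sin_sq_add_cos_sq (0 + 2 * B * i) + z ^ 2 * hpow i +
      hz / 4 + hd / 4
  have hb : ∀ i, x i ≠ F 0 0 0 (-(d / 2)) := by
    intro i
    refine hF _ _ _ _ _ _ _ _ (hdisc _) (hzε i) h0ε (by norm_num) h0ε (by rwa [abs_neg]) ?_
    linear_combination ρ ^ 2 * Real.sin_sq_add_cos_sq (0 + 2 * B * i) + z ^ 2 * hpow i +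
      hz / 4 + hd / 4
  have hchord : ∀ t u, (ρ * Real.cos (t + 2 * u) - ρ * Real.cos t) ^ 2 +
      (ρ * Real.sin (t + 2 * u) - ρ * Real.sin t) ^ 2 = (2 * ρ * Real.sin u) ^ 2 := by
    intro t u
    have h1 := Real.cos_sub (t + 2 * u) t
    rw [add_sub_cancel_left, Real.cos_two_mul, Real.cos_sq'] at h1
    linear_combination ρ ^ 2 * Real.sin_sq_add_cos_sq (t + 2 * u) +
      ρ ^ 2 * Real.sin_sq_add_cos_sq t + 2 * ρ ^ 2 * h1
  have h0 : ∀ i, x (i + m) ≠ x i := by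
    intro i
    refine hF _ _ _ _ _ _ _ _ (hdisc _) (hzε _) h0ε (hdisc _) (hzε _) h0ε ?_
    have hang : 0 + 2 * B * ((i + m : ℕ) : ℝ) = 0 + 2 * B * i + 2 * (Real.pi / 6 + B) := by
      push_cast; linear_combination 2 * hmB
    rw [hang, hchord, hρ, pow_add, hm.neg_one_pow]
    ring
  have h1 : ∀ i, x (i + m) ≠ x (i + 1) := by
    intro i
    refine hF _ _ _ _ _ _ _ _ (hdisc _) (hzε _) h0ε (hdisc _) (hzε _) h0ε ?_
    have hang : 0 + 2 * B * ((i + m : ℕ) : ℝ) =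
        0 + 2 * B * ((i + 1 : ℕ) : ℝ) + 2 * (Real.pi / 6) := by
      push_cast; linear_combination 2 * hmB
    rw [hang, hchord, Real.sin_pi_div_six, pow_add, pow_add, hm.neg_one_pow]
    linear_combination 4 * z ^ 2 * hpow i + hz
  obtain ⟨c, hc⟩ := exists_injOn_mod_three _ _ hne
  refine false_of_cyclic_three_colouring (c := fun i => c (x i)) (N := 6 * (m - 1)) (m := m)
    (by omega) (fun i => congrArg c (hxper i)) ?_
    (fun i => hc _ _ (ha _) (hb _) (ha _) (hb _) (h0 i))
    (fun i => hc _ _ (ha _) (hb _) (ha _) (hb _) (h1 i))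
  exact hp.zigzagWinding_eq_zero hF (w := fun i j => (c j - c i).bmod 3)
    (fun i j => by rw [← bmod_three_neg, neg_sub]) hN hB hρ0 hρ1 hL.symm 0

/-! ### Choice of parameters -/

/-- The radii of circles containing a unit polygon with an odd number of vertices are dense. -/
theorem exists_odd_polygon_radius {L κ : ℝ} (hL : 0 < L) (hκ : 0 < κ) (h : L + κ < 3 / 4) :
    ∃ (σ : ℝ) (p q : ℕ), 0 < σ ∧ Odd q ∧ 2 * σ * Real.sin (Real.pi * p / q) = 1 ∧
      L < 1 - σ ^ 2 ∧ 1 - σ ^ 2 < L + κ := by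
  set r := √(1 - L - κ / 2) with hr
  have hr2 : r ^ 2 = 1 - L - κ / 2 := Real.sq_sqrt (by linarith)
  have hr0 : 1 / 2 < r := Real.lt_sqrt_of_sq_lt (by linarith)
  set y := 1 / (2 * r) with hy
  have hy0 : 0 < y := by positivity
  have hy1 : y ≤ 1 := by rw [hy, div_le_one (by linarith)]; linarith
  set x := Real.arcsin y / Real.pi with hx
  have hx0 : 0 ≤ x := div_nonneg (Real.arcsin_nonneg.2 hy0.le) Real.pi_pos.le
  have hsin : Real.sin (Real.pi * x) = y := by
    rw [hx, mul_div_cancel₀ _ Real.pi_ne_zero, Real.sin_arcsin (by linarith) hy1]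
  have hc : ContinuousAt (fun t => 1 - (1 / (2 * Real.sin (Real.pi * t))) ^ 2) x := by
    have : 2 * Real.sin (Real.pi * x) ≠ 0 := by rw [hsin]; positivity
    fun_prop (disch := exact this)
  have hcs : ContinuousAt (fun t => Real.sin (Real.pi * t)) x := by fun_prop
  have hval : 1 - (1 / (2 * Real.sin (Real.pi * x))) ^ 2 = L + κ / 2 := by
    have : 1 / (2 * y) = r := by rw [hy]; field_simp
    rw [hsin, this, hr2]; ring
  have hev := (hc.eventually_mem (Ioo_mem_nhds (a := L) (b := L + κ)
    (by rw [hval]; linarith) (by rw [hval]; linarith))).and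
    (hcs.eventually_mem (Ioi_mem_nhds (a := 0) (by rw [hsin]; exact hy0)))
  obtain ⟨δ, hδ, hball⟩ := Metric.eventually_nhds_iff.1 hev
  obtain ⟨n, hn⟩ := exists_nat_gt (1 / δ)
  set q := 2 * n + 1 with hq
  have hq0 : (0 : ℝ) < q := by rw [hq]; positivity
  have hqδ : 1 / δ < q := hn.trans_le (by rw [hq]; push_cast; linarith [Nat.cast_nonneg (α := ℝ) n])
  -- Rounding to a fraction with large odd denominator stays in the window given by continuity.
  set p := ⌊x * q⌋₊ with hp
  have hp1 : (p : ℝ) ≤ x * q := Nat.floor_le (by positivity)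
  have hp2 : x * q < p + 1 := Nat.lt_floor_add_one _
  have hdist : dist ((p : ℝ) / q) x < δ := by
    have h1 : 1 < q * δ := by rwa [div_lt_iff₀ hδ] at hqδ
    rw [Real.dist_eq, abs_lt, lt_sub_iff_add_lt, sub_lt_iff_lt_add, lt_div_iff₀ hq0, div_lt_iff₀ hq0]
    constructor <;> nlinarith
  obtain ⟨⟨h1, h2⟩, h3⟩ := hball hdist
  rw [← mul_div_assoc] at h1 h2 h3
  have h3' : 0 < Real.sin (Real.pi * p / q) := h3
  refine ⟨1 / (2 * Real.sin (Real.pi * p / q)), p, q, by positivity, ⟨n, rfl⟩, ?_, h1, h2⟩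
  field_simp

theorem exists_excess {L S : ℝ} (hL : 0 < L) (hL1 : L < 1 / 4) (hS : 0 < S) (hS1 : S ≤ 1) :
    ∃ μ, 0 < μ ∧ μ ≤ S ^ 2 ∧ ∃ (σ : ℝ) (p q : ℕ), 0 < σ ∧
      σ ^ 2 * (L + μ) = L + μ - (L + μ / 2) ^ 2 ∧ Odd q ∧
      2 * σ * Real.sin (Real.pi * p / q) = 1 := by
  have hS4 : S ^ 4 ≤ S ^ 2 := pow_le_pow_of_le_one hS.le hS1 (by norm_num)
  have hS2 : S ^ 2 ≤ 1 := pow_le_one₀ hS.le hS1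
  obtain ⟨σ, p, q, hσ, hq, hpq, h1, h2⟩ := exists_odd_polygon_radius (κ := S ^ 4 / 64) hL
    (by positivity) (by linarith)
  obtain ⟨κ, hκ⟩ : ∃ κ, κ = 1 - σ ^ 2 - L := ⟨_, rfl⟩
  have hκ0 : 0 < κ := by linarith
  have hκ1 : κ ≤ S ^ 4 / 64 := by linarith
  set T := √(κ ^ 2 + κ * L) with hT
  have hT2 : T ^ 2 = κ ^ 2 + κ * L := Real.sq_sqrt (by positivity)
  have hT0 : 0 ≤ T := Real.sqrt_nonneg _
  have hT1 : T ≤ S ^ 2 / 4 := by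
    apply abs_le_of_sq_le_sq' _ (by positivity) |>.2
    rw [hT2]
    nlinarith
  -- The positive root of `μ² / 4 - κ μ - κ L = 0`, which says that the squared circumradius is `L +
  -- κ = 1 - σ²`.
  refine ⟨2 * κ + 2 * T, by positivity, by linarith, σ, p, q, hσ, ?_, hq, hpq⟩
  have : σ ^ 2 = 1 - L - κ := by rw [hκ]; ring
  rw [this]
  linear_combination hT2

/-- The radius of the circle in which the chord of angle `2 * (π / 6 + B)` has length one. -/
theorem exists_zigzag_radius {B : ℝ} (hB0 : 0 < B) (hB1 : B ≤ 1 / 20) :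
    ∃ ρ, 0 < ρ ∧ ρ ^ 2 ≤ 1 ∧ 2 * ρ * Real.sin (Real.pi / 6 + B) = 1 ∧
      1 - ρ ^ 2 ≤ 6 * Real.sin B ∧ 2 / 5 * Real.sin B ≤ 1 - ρ ^ 2 := by
  set S := Real.sin B with hS
  set C := Real.cos B with hC
  have hS0 : 0 < S := Real.sin_pos_of_pos_of_lt_pi hB0 (by linarith [Real.pi_gt_three])
  have hSδ : S ≤ 1 / 20 := (Real.sin_le hB0.le).trans hB1
  have hC0 : 1 / 2 ≤ C := by
    have := Real.one_sub_sq_div_two_le_cos (x := B)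
    nlinarith
  have hC1 : C ≤ 1 := Real.cos_le_one B
  have hsc : S ^ 2 + C ^ 2 = 1 := Real.sin_sq_add_cos_sq B
  have h3 : √3 ^ 2 = (3 : ℝ) := Real.sq_sqrt (by norm_num)
  have h3' : (1.7 : ℝ) ≤ √3 := Real.le_sqrt_of_sq_le (by norm_num)
  have h3'' : √3 ≤ (2 : ℝ) := Real.sqrt_le_iff.2 (by norm_num)
  have hsinA : Real.sin (Real.pi / 6 + B) = C / 2 + √3 / 2 * S := by
    rw [Real.sin_add, Real.sin_pi_div_six, Real.cos_pi_div_six]; ring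
  set A := Real.sin (Real.pi / 6 + B) with hA
  have hA0 : 0 < A := by rw [hsinA]; positivity
  have hA2 : 4 * A ^ 2 = 1 + 2 * S * (S + √3 * C) := by
    rw [hsinA]; linear_combination hsc + S ^ 2 * h3
  obtain ⟨u, hu⟩ : ∃ u, u = S + √3 * C := ⟨_, rfl⟩
  have hu1 : 4 / 5 ≤ u := by rw [hu]; nlinarith
  have hu2 : u ≤ 3 := by rw [hu]; nlinarith
  rw [← hu] at hA2
  obtain ⟨ρ, hρ⟩ : ∃ ρ, ρ = 1 / (2 * A) := ⟨_, rfl⟩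
  have hρA : 2 * ρ * A = 1 := by rw [hρ]; field_simp
  have hρ0 : 0 < ρ := by rw [hρ]; positivity
  have hρ2 : ρ ^ 2 * (1 + 2 * S * u) = 1 := by
    rw [← hA2]; linear_combination (2 * ρ * A + 1) * hρA
  have hSu : 0 < S * u := by positivity
  have hρ1 : ρ ^ 2 ≤ 1 := by nlinarith [mul_pos (pow_pos hρ0 2) hSu]
  have hgap : 1 - ρ ^ 2 = ρ ^ 2 * (2 * S * u) := by linear_combination -hρ2
  have hup : 1 - ρ ^ 2 ≤ 6 * S := by
    rw [hgap]
    calc ρ ^ 2 * (2 * S * u) ≤ 1 * (2 * S * u) := by gcongr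
      _ = S * (2 * u) := by ring
      _ ≤ S * 6 := by gcongr; linarith
      _ = 6 * S := by ring
  have hlow : 2 / 5 * S ≤ 1 - ρ ^ 2 := by
    rw [hgap]
    have : 1 / 4 ≤ ρ ^ 2 := by nlinarith
    calc 2 / 5 * S = 1 / 4 * (2 * S * (4 / 5)) := by ring
      _ ≤ ρ ^ 2 * (2 * S * u) := by gcongr
  exact ⟨ρ, hρ0, hρ1, hρA, hup, hlow⟩

/-- `L` is of order `sin B`, while the horizontal parts of the triangles have squares of order `sin
B ^ 2`; a small `B` therefore makes them both small and steep. -/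
theorem exists_antiprismParameters {ε : ℝ} (hε : 0 < ε) :
    ∃ (m : ℕ) (B L μ ρ z d : ℝ), AntiprismParameters ε B L μ ∧ Even m ∧ 2 ≤ m ∧
      ((6 * (m - 1) : ℕ) : ℝ) * B = Real.pi ∧ 0 ≤ ρ ∧ ρ ≤ 1 ∧
      2 * ρ * Real.sin (Real.pi / 6 + B) = 1 ∧ 4 * z ^ 2 = 1 - ρ ^ 2 ∧
      d ^ 2 = 3 * (1 - ρ ^ 2) ∧ 0 < d ∧ d ≤ ε ∧ L = z ^ 2 + ρ ^ 2 * Real.sin B ^ 2 := by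
  obtain ⟨δ, hδ⟩ : ∃ δ, δ = min (ε ^ 2 / 80) (1 / 20) := ⟨_, rfl⟩
  have hδ0 : 0 < δ := by rw [hδ]; positivity
  have hδ1 : δ ≤ ε ^ 2 / 80 := hδ ▸ min_le_left _ _
  have hδ2 : δ ≤ 1 / 20 := hδ ▸ min_le_right _ _
  obtain ⟨n, hn⟩ := exists_nat_ge (Real.pi / δ)
  obtain ⟨B, hB⟩ : ∃ B, B = Real.pi / ((6 * (2 * n + 1) : ℕ) : ℝ) := ⟨_, rfl⟩
  have hN0 : (0 : ℝ) < ((6 * (2 * n + 1) : ℕ) : ℝ) := by positivity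
  have hB0 : 0 < B := by rw [hB]; exact div_pos Real.pi_pos hN0
  have hBδ : B ≤ δ := by
    rw [hB, div_le_iff₀ hN0]
    rw [div_le_iff₀ hδ0] at hn
    push_cast
    nlinarith [Nat.cast_nonneg (α := ℝ) n]
  set S := Real.sin B with hS
  have hS0 : 0 < S := Real.sin_pos_of_pos_of_lt_pi hB0 (by linarith [Real.pi_gt_three])
  have hSδ : S ≤ δ := (Real.sin_le hB0.le).trans hBδ
  have hC0 : 0 < Real.cos B := Real.cos_pos_of_mem_Ioo ⟨by linarith [Real.pi_gt_three],
    by linarith [Real.pi_gt_three]⟩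
  obtain ⟨ρ, hρ0, hρ1, hρA, hup, hlow⟩ := exists_zigzag_radius hB0 (hBδ.trans hδ2)
  obtain ⟨z, hz⟩ : ∃ z, z = √((1 - ρ ^ 2) / 4) := ⟨_, rfl⟩
  have hz2 : z ^ 2 = (1 - ρ ^ 2) / 4 := by rw [hz]; exact Real.sq_sqrt (by linarith)
  obtain ⟨d, hd⟩ : ∃ d, d = √(3 * (1 - ρ ^ 2)) := ⟨_, rfl⟩
  have hd2 : d ^ 2 = 3 * (1 - ρ ^ 2) := by rw [hd]; exact Real.sq_sqrt (by linarith)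
  have hd0 : 0 < d := by rw [hd]; exact Real.sqrt_pos.2 (by linarith)
  obtain ⟨L, hL⟩ : ∃ L, L = z ^ 2 + ρ ^ 2 * S ^ 2 := ⟨_, rfl⟩
  have hρS : ρ ^ 2 * S ^ 2 ≤ S ^ 2 := mul_le_of_le_one_left (sq_nonneg _) hρ1
  have hρS0 : 0 ≤ ρ ^ 2 * S ^ 2 := by positivity
  have hSS : S ^ 2 ≤ 1 / 20 * S := by nlinarith
  have hL0 : S / 10 ≤ L := by linarith
  have hL1 : L ≤ 2 * S := by linarith
  obtain ⟨μ, hμ0, hμ1, hpoly⟩ := exists_excess (L := L) (S := S) (by linarith) (by linarith) hS0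
    (by linarith)
  refine ⟨2 * n + 2, B, L, μ, ρ, z, d, ⟨hε, by linarith, hμ0, by linarith, hC0, hμ1, ?_,
    hpoly⟩, ⟨n + 1, by ring⟩, by omega, ?_, hρ0.le, by nlinarith, hρA, by linarith, hd2, hd0, ?_,
    hL⟩
  · have h1 : 8 * S ^ 2 ≤ ε ^ 2 * (S / 10) := by nlinarith [mul_le_mul_of_nonneg_right (hSδ.trans hδ1) hS0.le]
    exact h1.trans (by gcongr)
  · rw [show 2 * n + 2 - 1 = 2 * n + 1 by omega, hB]
    field_simp
  · exact abs_le_of_sq_le_sq' (by rw [hd2]; linarith) hε.le |>.2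

/-! ### Tilting the axis and chaining steps -/

/-- The unit-distance graph of the plane times a small square has no proper five-colouring. -/
theorem not_colorable_five_planeTimesSquare {ε : ℝ} (hε : 0 < ε) :
    ¬ (unitDistanceGraph (planeTimesSquare ε)).Colorable 5 := by
  rintro ⟨f⟩
  classical
  set G : ℝ → ℝ → ℝ → ℝ → Fin 5 := fun x y z t =>
    if h : !₂[x, y, z, t] ∈ planeTimesSquare ε then f ⟨!₂[x, y, z, t], h⟩ else 0 with hGdef
  have hG : ∀ x y z t x' y' z' t' : ℝ, z ∈ Set.Icc 0 ε → t ∈ Set.Icc 0 ε → z' ∈ Set.Icc 0 ε →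
      t' ∈ Set.Icc 0 ε → (x - x') ^ 2 + (y - y') ^ 2 + (z - z') ^ 2 + (t - t') ^ 2 = 1 →
      G x y z t ≠ G x' y' z' t' := by
    intro x y z t x' y' z' t' h1 h2 h3 h4 h
    have hm : !₂[x, y, z, t] ∈ planeTimesSquare ε := ⟨by simpa using h1, by simpa using h2⟩
    have hm' : !₂[x', y', z', t'] ∈ planeTimesSquare ε := ⟨by simpa using h3, by simpa using h4⟩
    simp only [hGdef, dif_pos hm, dif_pos hm']
    apply f.valid
    change dist _ _ = (1 : ℝ)
    rw [Subtype.dist_eq, EuclideanSpace.dist_eq]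
    simp [Fin.sum_univ_four, Real.dist_eq, sq_abs, h]
  obtain ⟨m, B, L, μ, ρ, z, d, hp, hm, hm2, hB, hρ0, hρ1, hρ, hz, hd, hd0, hdε, hL⟩ :=
    -- The quarter leaves room for the tilt, which moves heights by at most `4 * s ≤ ε / 8` over the
    -- disc of radius 4.
    exists_antiprismParameters (ε := ε / 4) (by positivity)
  -- a zigzag of steps of length `d` joining two points at distance one
  obtain ⟨n, hn⟩ := exists_nat_gt (16 / (d * ε) + 1 / d)
  have hn0 : (0 : ℝ) < n := lt_trans (by positivity) hn
  obtain ⟨h, hh⟩ : ∃ h : ℝ, h = 1 / (2 * n) := ⟨_, rfl⟩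
  have hh0 : 0 < h := by rw [hh]; positivity
  have hhn : h * (2 * n) = 1 := by rw [hh]; field_simp
  have hhε : 32 * h ≤ d * ε := by
    have h1 : 16 / (d * ε) < n := lt_of_le_of_lt (by simp [hd0.le]) hn
    rw [div_lt_iff₀ (by positivity)] at h1
    rw [hh, mul_one_div, div_le_iff₀ (by positivity)]
    linarith
  have hhd : h ≤ d := by
    have h1 : 1 / d < n := lt_of_le_of_lt (by simp only [le_add_iff_nonneg_left]; positivity) hn
    rw [div_lt_iff₀ hd0] at h1
    rw [hh, div_le_iff₀ (by positivity)]
    linarith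
  obtain ⟨v, hv⟩ : ∃ v, v = √(d ^ 2 - h ^ 2) := ⟨_, rfl⟩
  have hv2 : v ^ 2 = d ^ 2 - h ^ 2 := by rw [hv]; exact Real.sq_sqrt (by nlinarith)
  set c : ℕ → Fin 5 := fun j => G (j * h) 0 (ε / 2) (ε / 2 + (-1) ^ j * (v / 2)) with hc
  obtain ⟨j, hj⟩ : ∃ j, c j ≠ c (j + 1) := by
    by_contra hall
    push Not at hall
    have hconst : ∀ j, c j = c 0 := fun j => by
      induction j with
      | zero => rfl
      | succ j ih => rw [← hall j, ih]
    have hvε : v / 2 ≤ ε / 2 := by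
      have : v ≤ d := by rw [hv]; exact Real.sqrt_le_iff.2 ⟨hd0.le, by nlinarith⟩
      linarith
    have hv0 : 0 ≤ v := hv ▸ Real.sqrt_nonneg _
    -- An even number `2 * n` of steps returns to the initial height, so the displacement is exactly
    -- one.
    refine hG _ _ _ _ _ _ _ _ ⟨?_, ?_⟩ ⟨?_, ?_⟩ ⟨?_, ?_⟩ ⟨?_, ?_⟩ ?_ (hconst (2 * n))
    any_goals first | linarith | (simp only [pow_zero, pow_mul, neg_one_sq, one_pow]; linarith)
    simp only [pow_mul, neg_one_sq, one_pow, pow_zero]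
    push_cast
    linear_combination (h * (2 * n) + 1) * hhn
  -- tilt the coordinates so that the step becomes vertical
  obtain ⟨s, hs⟩ : ∃ s, s = h / d := ⟨_, rfl⟩
  obtain ⟨k, hk⟩ : ∃ k, k = -((-1) ^ j * (v / d)) := ⟨_, rfl⟩
  have hpow : ((-1 : ℝ) ^ j) ^ 2 = 1 := by rw [← pow_mul, mul_comm j 2, pow_mul, neg_one_sq, one_pow]
  have hsd : s * d = h := by rw [hs]; field_simp
  have hkd : k * d = -((-1) ^ j * v) := by rw [hk]; field_simp
  have hsk : s ^ 2 + k ^ 2 = 1 := by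
    have : d ^ 2 * (s ^ 2 + k ^ 2) = d ^ 2 * 1 := by
      linear_combination (s * d + h) * hsd + (k * d - (-1) ^ j * v) * hkd + v ^ 2 * hpow + hv2
    exact mul_left_cancel₀ (by positivity) this
  have hs0 : 0 ≤ s := by rw [hs]; positivity
  have hsε : 32 * s ≤ ε := by
    rw [hs, ← mul_div_assoc, div_le_iff₀ hd0]; linarith
  have hk1 : |k| ≤ 1 := by apply abs_le_of_sq_le_sq _ zero_le_one; nlinarith
  set F : ℝ → ℝ → ℝ → ℝ → Fin 5 := fun x y z t =>
    G ((j + 1 / 2) * h + k * x + s * t) y (ε / 2 + z) (ε / 2 - s * x + k * t) with hFdef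
  have hF : ProperOnThickDisc (ε / 4) F := by
    have hz : ∀ z : ℝ, |z| ≤ ε / 4 → ε / 2 + z ∈ Set.Icc 0 ε := fun z hz => by
      rw [abs_le] at hz; constructor <;> linarith
    have ht : ∀ x y t : ℝ, x ^ 2 + y ^ 2 ≤ 16 → |t| ≤ ε / 4 →
        ε / 2 - s * x + k * t ∈ Set.Icc 0 ε := by
      intro x y t hxy ht
      have hx : |x| ≤ 4 := by apply abs_le_of_sq_le_sq _ (by norm_num); nlinarith [sq_nonneg y]
      have h1 : |s * x| ≤ s * 4 := by rw [abs_mul, abs_of_nonneg hs0]; gcongr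
      have h2 : |k * t| ≤ 1 * (ε / 4) := by
        rw [abs_mul]; exact mul_le_mul hk1 ht (abs_nonneg _) zero_le_one
      rw [abs_le] at h1 h2
      constructor <;> linarith
    intro x y z t x' y' z' t' h1 h2 h3 h4 h5 h6 hdist
    refine hG _ _ _ _ _ _ _ _ (hz z h2) (ht x y t h1 h3) (hz z' h5) (ht x' y' t' h4 h6) ?_
    linear_combination hdist + ((x - x') ^ 2 + (t - t') ^ 2) * hsk
  have key := hp.axis_color_eq hF hm hm2 hB hρ0 hρ1 hρ hz hd
    (by rw [abs_of_pos hd0]; linarith) hL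
  apply hj
  have e1 : c j = F 0 0 0 (-(d / 2)) := by
    simp only [hc, hFdef]
    congr 1
    · linear_combination hsd / 2
    · ring
    · linear_combination hkd / 2
  have e2 : c (j + 1) = F 0 0 0 (d / 2) := by
    simp only [hc, hFdef]
    congr 1
    · push_cast; linear_combination -hsd / 2
    · ring
    · rw [pow_succ]; linear_combination -hkd / 2
  rw [e1, e2, key]

theorem mainTheorem2 (ε : ℝ) (hε : 0 < ε) :
    6 ≤ (unitDistanceGraph (planeTimesSquare ε)).chromaticNumber := by
  by_contra hlt
  push Not at hlt
  refine not_colorable_five_planeTimesSquare hε ?_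
  rw [← SimpleGraph.chromaticNumber_le_iff_colorable]
  have h6 : (6 : ℕ∞) = (5 : ℕ) + 1 := by norm_num
  rw [h6] at hlt
  exact (ENat.lt_add_one_iff (ENat.natCast_ne_top 5)).1 hlt
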